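/- Let $b>-1$ and, for $\eta>0$, consider the generalized Charlier weight on $\{0,1,2,\dots\}$, $$w(k)=\frac{1}{(b+1)_k}\,\frac{\eta^k}{k!},\qquad (b+1)_k=(b+1)(b+2)\cdots(b+k),$$ and the linear functional $\langle\rho,p\rangle=\sum_{k\ge 0}p(k)w(k)$ on real polynomials. Let $P_n$ be its monic orthogonal polynomials (the monic Gram–Schmidt orthogonalization of $1,z,z^2,\dots$), $H_n=\langle\rho,P_n^2\rangle$, and let $\beta_n=\langle\rho,zP_n^2\rangle/H_n$ and $\gamma_n=\langle\rho,zP_nP_{n-1}\rangle/H_{n-1}$ ($n\ge1$), $\gamma_0=0$, be the entries of the Jacobi matrix, regarded as functions of $\eta\in(0,\infty)$. Write $\vartheta_\eta=\eta\,\frac{d}{d\eta}$. Then for every integer $n\ge1$ the following hold. 1. For every $\eta>0$, the series $\sum_k p(k)w(k)$ converges for every polynomial $p$, $P_n$ is monic of degree $n$ with $\langle\rho,P_nz^m\rangle=0$ for $0\le m<n$, $H_n>0$, $\gamma_n>0$, and $zP_n=P_{n+1}+\beta_nP_n+\gamma_nP_{n-1}$. As functions of $\eta$ on $(0,\infty)$,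 $\gamma_n$ is twice continuously differentiable and $\beta_n$ is differentiable. 2. For every $\eta>0$, the pair $(\beta_n,\gamma_n)$ satisfies the first-order system $$(\eta-\gamma_n)(\vartheta_\eta\beta_n+\gamma_n)=\eta\big(\eta+(b-n)n+(2n-b-\beta_n)\beta_n-\gamma_n\big),\qquad \vartheta_\eta\gamma_n=(b-n+1+2\beta_n)\gamma_n-n\eta,$$ and hence $$\beta_n=\tfrac12\Big(\vartheta_\eta\log\gamma_n+\frac{n\eta}{\gamma_n}-b+n-1\Big).$$ 3. For every $\eta>0$, $\gamma_n$ satisfies the second-order nonlinear ODE $$\Big(1-\frac{\gamma_n}{\eta}\Big)\Big(\vartheta_\eta\Big(\frac{\vartheta_\eta\gamma_n}{\gamma_n}+\frac{n\eta}{\gamma_n}\Big)+2\gamma_n\Big)+2\big(\gamma_n-\eta+(n-b)n\big)=-\frac12\Big(\frac{\vartheta_\eta\gamma_n}{\gamma_n}+\frac{n\eta}{\gamma_n}\Big)^2+(n+1)\Big(\frac{\vartheta_\eta\gamma_n}{\gamma_n}+\frac{n\eta}{\gamma_n}\Big)+\frac12(-b+n-1)(-b+3n+1).$$ -/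

import Mathlib

open Polynomial

noncomputable section

namespace GenCharlier

/-- The generalized Charlier weight on the nodes `k = 0, 1, 2, …`:
`w(k) = η ^ k / ((b + 1)_k k!)`, with `(b + 1)_k = (b + 1)(b + 2)⋯(b + k)`. -/
def weight (b η : ℝ) (k : ℕ) : ℝ :=
  η ^ k / ((ascPochhammer ℝ k).eval (b + 1) * (k.factorial : ℝ))

/-- The linear functional `⟨ρ, p⟩ = ∑ₖ p(k) w(k)` on polynomials. -/
def functional (b η : ℝ) (p : ℝ[X]) : ℝ :=
  ∑' k : ℕ, p.eval (k : ℝ) * weight b η k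

/-- The monic orthogonal polynomials `Pₙ` of the functional: the monic Gram--Schmidt
orthogonalization of `1, z, z², …` for the bilinear form `⟨ρ, p q⟩`. -/
def monicOP (b η : ℝ) (n : ℕ) : ℝ[X] :=
  X ^ n - ∑ m : Fin n,
    C (functional b η (X ^ n * monicOP b η m) /
        functional b η (monicOP b η m * monicOP b η m)) * monicOP b η m
termination_by n
decreasing_by all_goals exact m.isLt

/-- The squared norm `Hₙ = ⟨ρ, Pₙ²⟩`. -/
def sqNorm (b η : ℝ) (n : ℕ) : ℝ :=
  functional b η (monicOP b η n * monicOP b η n)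

/-- The Jacobi matrix entry `J n m = ⟨ρ, z Pₙ Pₘ⟩ / Hₘ`: the coefficient of `Pₘ` in `z Pₙ`. -/
def jacobi (b η : ℝ) (n m : ℕ) : ℝ :=
  functional b η (X * monicOP b η n * monicOP b η m) / sqNorm b η m

/-- The recursion coefficient `βₙ`, as a function of `η`: the diagonal of the Jacobi matrix. -/
def beta (b : ℝ) (n : ℕ) (η : ℝ) : ℝ := jacobi b η n n

/-- The recursion coefficient `γₙ`, as a function of `η`: the subdiagonal of the Jacobi
matrix, with the convention `γ₀ = 0`. -/
def gamma (b : ℝ) : ℕ → ℝ → ℝ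
  | 0, _ => 0
  | n + 1, η => jacobi b η (n + 1) n

/-- The Euler operator `ϑ = η d/dη`. -/
def euler (f : ℝ → ℝ) (η : ℝ) : ℝ := η * deriv f η

end GenCharlier

end

/-! The weight satisfies (k+1)(k+1+b) w(k+1) = η w(k). As an identity for ρ, this Pearson equation
reads ⟨ρ, z(z+b)f(z)⟩ = η⟨ρ, f(z+1)⟩ (`functional_pearson`). With s_n the subleading coefficient of
P_n, we have β_n = s_n - s_{n+1} and γ_{n+1} = H_{n+1}/H_n. Testing the Pearson equation on
(P_{n+1}, P_n) and (P_{n+2}, P_n) gives two relations (`sqNorm_succ_mul`, `sqNorm_succ_succ`), and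
induction turns them into the discrete Painlevé relation `painleve`.

Since ϑw(k) = k w(k), differentiating the orthogonality relations gives the Toda equations ϑβ_n =
γ_{n+1} - γ_n and ϑγ_n = γ_n(β_n - β_{n-1}). Eliminating γ_{n+1} by `painleve` and β_{n-1} by
`sqNorm_succ_mul` yields the first-order system. Its second equation makes β_n explicit in γ_n, and
substitution into the first gives the ODE. -/

noncomputable section

namespace GenCharlier

/-! ### Monic orthogonal polynomials of an abstract positive functional -/

/-- `P` is the sequence of monic orthogonal polynomials of a functional `L` for which the squared
norms are positive. -/
structure IsMonicOP (L : ℝ[X] →ₗ[ℝ] ℝ) (P : ℕ → ℝ[X]) : Prop where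
  monic : ∀ n, (P n).Monic
  natDegree : ∀ n, (P n).natDegree = n
  orth : ∀ (n : ℕ) (q : ℝ[X]), q.degree < (n : WithBot ℕ) → L (q * P n) = 0
  pos : ∀ n, 0 < L (P n * P n)

/-- The coefficient of `z ^ (n - 1)` in `P n`, which is `0` for `n = 0`. -/
def subCoeff (P : ℕ → ℝ[X]) (n : ℕ) : ℝ := (X * P n).coeff n

@[simp] lemma subCoeff_zero (P : ℕ → ℝ[X]) : subCoeff P 0 = 0 := by
  simp [subCoeff]

@[simp] lemma subCoeff_succ (P : ℕ → ℝ[X]) (n : ℕ) :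
    subCoeff P (n + 1) = (P (n + 1)).coeff n := by
  simp [subCoeff, coeff_X_mul]

lemma coeff_taylor_of_natDegree_le (r : ℝ) {f : ℝ[X]} {k : ℕ} (hf : f.natDegree ≤ k + 2) :
    (taylor r f).coeff k = f.coeff k + (k + 1) * f.coeff (k + 1) * r
      + (k + 2) * (k + 1) / 2 * f.coeff (k + 2) * r ^ 2 := by
  have hd : (hasseDeriv k f).natDegree < 3 := by
    have := natDegree_hasseDeriv_le f k
    omega
  have h2 : (((2 + k).choose k : ℕ) : ℝ) = (k + 2) * (k + 1) / 2 := by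
    rw [add_comm, Nat.choose_symm_add, Nat.cast_choose_two]
    push_cast
    ring
  have h1 : (((1 + k).choose k : ℕ) : ℝ) = k + 1 := by
    rw [add_comm, Nat.choose_symm_add]
    simp
  rw [taylor_coeff, eval_eq_sum_range' hd]
  simp only [Finset.sum_range_succ, Finset.sum_range_zero, hasseDeriv_coeff, h1, h2]
  simp [add_comm]

namespace IsMonicOP

variable {L : ℝ[X] →ₗ[ℝ] ℝ} {P : ℕ → ℝ[X]}

lemma coeff_self (h : IsMonicOP L P) (n : ℕ) : (P n).coeff n = 1 := by
  have := h.monic n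
  rwa [Monic, leadingCoeff, h.natDegree] at this

lemma coeff_of_lt (h : IsMonicOP L P) {n k : ℕ} (hk : n < k) : (P n).coeff k = 0 :=
  coeff_eq_zero_of_natDegree_lt (by rwa [h.natDegree])

lemma degree (h : IsMonicOP L P) (n : ℕ) : (P n).degree = n := by
  rw [degree_eq_natDegree (h.monic n).ne_zero, h.natDegree]

lemma apply_mul (h : IsMonicOP L P) {q : ℝ[X]} {m : ℕ} (hq : q.natDegree ≤ m) :
    L (q * P m) = q.coeff m * L (P m * P m) := by
  have hr : (q - C (q.coeff m) * P m).degree < (m : WithBot ℕ) := by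
    rw [degree_lt_iff_coeff_zero]
    intro k hk
    rcases hk.eq_or_lt with rfl | hk
    · simp [h.coeff_self]
    · simp [h.coeff_of_lt hk, coeff_eq_zero_of_natDegree_lt (hq.trans_lt hk)]
  have := h.orth m _ hr
  rw [sub_mul, map_sub, mul_assoc, ← smul_eq_C_mul, map_smul, smul_eq_mul] at this
  linarith

lemma apply_mul_of_lt (h : IsMonicOP L P) {k m : ℕ} (hkm : m < k) : L (P k * P m) = 0 := by
  rw [mul_comm]
  exact h.orth k _ (by rw [h.degree]; exact_mod_cast hkm)

/-- Subtracting a multiple of P_{m+1}, which is orthogonal to P_m, reduces the degree to m. -/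
lemma apply_mul_succ (h : IsMonicOP L P) {q : ℝ[X]} {m : ℕ} (hq : q.natDegree ≤ m + 1) :
    L (q * P m) = (q.coeff m - q.coeff (m + 1) * subCoeff P (m + 1)) * L (P m * P m) := by
  have hr : (q - C (q.coeff (m + 1)) * P (m + 1)).natDegree ≤ m := by
    rw [natDegree_le_iff_coeff_eq_zero]
    intro k hk
    rcases (Nat.succ_le_of_lt hk).eq_or_lt with rfl | hk
    · simp [h.coeff_self]
    · simp only [coeff_sub, coeff_C_mul]
      rw [h.coeff_of_lt hk, coeff_eq_zero_of_natDegree_lt (hq.trans_lt hk)]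
      simp
  have := h.apply_mul hr
  rw [sub_mul, map_sub, mul_assoc, ← smul_eq_C_mul, map_smul, h.apply_mul_of_lt m.lt_succ_self,
    smul_zero, sub_zero, coeff_sub, coeff_C_mul] at this
  rw [this, subCoeff_succ]

lemma apply_mul_succ_succ (h : IsMonicOP L P) {q : ℝ[X]} {m : ℕ} (hq : q.natDegree ≤ m + 2) :
    L (q * P m) = (q.coeff m - q.coeff (m + 2) * (P (m + 2)).coeff m
      - (q.coeff (m + 1) - q.coeff (m + 2) * subCoeff P (m + 2)) * subCoeff P (m + 1))
        * L (P m * P m) := by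
  have hr : (q - C (q.coeff (m + 2)) * P (m + 2)).natDegree ≤ m + 1 := by
    rw [natDegree_le_iff_coeff_eq_zero]
    intro k hk
    rcases (Nat.succ_le_of_lt hk).eq_or_lt with rfl | hk
    · simp [h.coeff_self]
    · simp only [coeff_sub, coeff_C_mul]
      rw [h.coeff_of_lt hk, coeff_eq_zero_of_natDegree_lt (hq.trans_lt hk)]
      simp
  have := h.apply_mul_succ hr
  rw [sub_mul, map_sub, mul_assoc, ← smul_eq_C_mul, map_smul,
    h.apply_mul_of_lt (show m < m + 2 by omega), smul_zero, sub_zero] at this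
  rw [this]
  simp

lemma eq_zero_of_orth (h : IsMonicOP L P) {q : ℝ[X]} (hq : ∀ k, L (q * P k) = 0) : q = 0 := by
  have h1 := h.apply_mul (le_refl q.natDegree)
  rw [hq, eq_comm, mul_eq_zero] at h1
  exact leadingCoeff_eq_zero.mp (h1.resolve_right (h.pos _).ne')

lemma natDegree_X_mul (h : IsMonicOP L P) (n : ℕ) : (X * P n).natDegree = n + 1 := by
  rw [Polynomial.natDegree_X_mul (h.monic n).ne_zero, h.natDegree]

lemma apply_X_mul_self (h : IsMonicOP L P) (n : ℕ) :
    L (X * P n * P n) = (subCoeff P n - subCoeff P (n + 1)) * L (P n * P n) := by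
  rw [h.apply_mul_succ (h.natDegree_X_mul n).le, coeff_X_mul, h.coeff_self, one_mul]
  rfl

lemma apply_X_mul_succ (h : IsMonicOP L P) (n : ℕ) :
    L (X * P n * P (n + 1)) = L (P (n + 1) * P (n + 1)) := by
  rw [h.apply_mul (h.natDegree_X_mul n).le, coeff_X_mul, h.coeff_self, one_mul]

lemma apply_X_mul_of_lt (h : IsMonicOP L P) {n k : ℕ} (hk : n + 1 < k) :
    L (X * P n * P k) = 0 := by
  rw [h.apply_mul ((h.natDegree_X_mul n).le.trans hk.le),
    coeff_eq_zero_of_natDegree_lt (by rwa [h.natDegree_X_mul]), zero_mul]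

lemma X_mul_eq (h : IsMonicOP L P) (n : ℕ) {β γ : ℝ}
    (hβ : L (X * P (n + 1) * P (n + 1)) = β * L (P (n + 1) * P (n + 1)))
    (hγ : L (X * P (n + 1) * P n) = γ * L (P n * P n)) :
    X * P (n + 1) = P (n + 2) + C β * P (n + 1) + C γ * P n := by
  rw [← sub_eq_zero]
  refine h.eq_zero_of_orth fun k => ?_
  have hs : ∀ i j, L (P i * P j) = if i = j then L (P i * P i) else 0 := by
    intro i j
    rcases lt_trichotomy i j with hij | rfl | hij
    · rw [mul_comm, h.apply_mul_of_lt hij, if_neg hij.ne]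
    · simp
    · rw [h.apply_mul_of_lt hij, if_neg hij.ne']
  simp only [sub_mul, add_mul, map_sub, map_add, ← smul_eq_C_mul, smul_mul_assoc, map_smul,
    smul_eq_mul]
  rw [hs (n + 2), hs (n + 1), hs n]
  rcases lt_or_ge k n with hk | hk
  · have : L (X * P (n + 1) * P k) = 0 := by
      rw [mul_right_comm, h.apply_X_mul_of_lt (by omega)]
    rw [this, if_neg (by omega), if_neg (by omega), if_neg (by omega)]
    ring
  obtain ⟨j, rfl⟩ := Nat.exists_eq_add_of_le hk
  match j with
  | 0 => simpa using sub_eq_zero.mpr hγ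
  | 1 => simpa using sub_eq_zero.mpr hβ
  | 2 => simp [h.apply_X_mul_succ]
  | j + 3 =>
    rw [h.apply_X_mul_of_lt (by omega), if_neg (by omega), if_neg (by omega), if_neg (by omega)]
    ring

/-! ### Consequences of the Pearson equation -/

section Pearson

variable {b η : ℝ}

/-- The Pearson equation for f(z) = q(z-1)p(z): the shift by 1 undoes the one on q. -/
lemma pearson_pair (hL : ∀ f, L (X * (X + C b) * f) = η * L (taylor 1 f)) (p q : ℝ[X]) :
    L (X * (X + C b) * taylor (-1) q * p) = η * L (taylor 1 p * q) := by
  rw [mul_assoc, hL, taylor_mul, taylor_taylor]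
  simp [mul_comm]

lemma coeff_taylor_self (h : IsMonicOP L P) (n : ℕ) (r : ℝ) : (taylor r (P n)).coeff n = 1 := by
  have := coeff_taylor_natDegree (r := r) (f := P n)
  rwa [h.natDegree, h.monic n] at this

lemma coeff_X_mul_taylor (h : IsMonicOP L P) (n : ℕ) (r : ℝ) :
    (X * taylor r (P n)).coeff n = subCoeff P n + n * r := by
  cases n with
  | zero => simp
  | succ k =>
    rw [coeff_X_mul, coeff_taylor_of_natDegree_le r (by rw [h.natDegree]; omega), h.coeff_self,
      h.coeff_of_lt (show k + 1 < k + 2 by omega)]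
    simp

/-- In `pearson_pair` for P_{n+1}, P_n each side exceeds the degree of its test polynomial by one,
so two top coefficients suffice. Divided by H_n, this is γ_{n+1}(b - n + β_n + β_{n+1}) = (n+1)η. -/
lemma sqNorm_succ_mul (h : IsMonicOP L P)
    (hL : ∀ f, L (X * (X + C b) * f) = η * L (taylor 1 f)) (n : ℕ) :
    (b - n + subCoeff P n - subCoeff P (n + 2)) * L (P (n + 1) * P (n + 1))
      = (n + 1) * η * L (P n * P n) := by
  have key := pearson_pair hL (P (n + 1)) (P n)
  have e : X * (X + C b) * taylor (-1) (P n)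
      = X * (X * taylor (-1) (P n)) + C b * (X * taylor (-1) (P n)) := by ring
  have hne : taylor (-1) (P n) ≠ 0 := (taylor_eq_zero _ _).not.mpr (h.monic n).ne_zero
  have hX : (X * taylor (-1) (P n)).natDegree = n + 1 := by
    rw [Polynomial.natDegree_X_mul hne, natDegree_taylor, h.natDegree]
  have hd : (X * (X + C b) * taylor (-1) (P n)).natDegree ≤ n + 1 + 1 := by
    rw [e]
    refine natDegree_add_le_of_degree_le ?_ ((natDegree_C_mul_le _ _).trans (by omega))
    exact natDegree_mul_le.trans (by rw [natDegree_X]; omega)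
  have c1 : (X * (X + C b) * taylor (-1) (P n)).coeff (n + 1) = subCoeff P n - n + b := by
    rw [e, coeff_add, coeff_X_mul, coeff_C_mul, coeff_X_mul, h.coeff_taylor_self,
      h.coeff_X_mul_taylor]
    ring
  have c2 : (X * (X + C b) * taylor (-1) (P n)).coeff (n + 1 + 1) = 1 := by
    rw [e, coeff_add, coeff_X_mul, coeff_C_mul, coeff_X_mul, h.coeff_taylor_self,
      coeff_eq_zero_of_natDegree_lt (p := X * taylor (-1) (P n)) (by omega)]
    simp
  have hd' : (taylor 1 (P (n + 1))).natDegree ≤ n + 1 := by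
    rw [natDegree_taylor, h.natDegree]
  have c3 := h.coeff_X_mul_taylor (n + 1) 1
  rw [coeff_X_mul] at c3
  rw [h.apply_mul_succ hd, h.apply_mul_succ hd', c1, c2, c3, h.coeff_taylor_self] at key
  push_cast at key
  linear_combination key

/-- Here the left side of `pearson_pair` is a monic polynomial of degree n+2 against P_{n+2}. On the
right the unknown coefficient of z^n in P_{n+2} cancels, leaving only subleading ones. -/
lemma sqNorm_succ_succ (h : IsMonicOP L P)
    (hL : ∀ f, L (X * (X + C b) * f) = η * L (taylor 1 f)) (n : ℕ) :
    L (P (n + 2) * P (n + 2)) = η * ((n + 1) * (n + 2) / 2 - subCoeff P (n + 1)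
      - (n + 1) * (subCoeff P (n + 1) - subCoeff P (n + 2))) * L (P n * P n) := by
  have key := pearson_pair hL (P (n + 2)) (P n)
  have hm : (X * (X + C b) * taylor (-1) (P n)).Monic :=
    (monic_X.mul (monic_X_add_C b)).mul (by
      rw [Monic, leadingCoeff_taylor, h.monic n])
  have hd : (X * (X + C b) * taylor (-1) (P n)).natDegree = n + 2 := by
    rw [(monic_X.mul (monic_X_add_C b)).natDegree_mul' , monic_X.natDegree_mul (monic_X_add_C b),
      natDegree_X, natDegree_X_add_C, natDegree_taylor, h.natDegree]
    · omega
    · exact (taylor_eq_zero _ _).not.mpr (h.monic n).ne_zero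
  have hc : (X * (X + C b) * taylor (-1) (P n)).coeff (n + 2) = 1 := by
    rw [← hd]; exact hm
  have hd' : (taylor 1 (P (n + 2))).natDegree ≤ n + 2 := by
    rw [natDegree_taylor, h.natDegree]
  have c1 := h.coeff_X_mul_taylor (n + 2) 1
  rw [coeff_X_mul] at c1
  have c0 := coeff_taylor_of_natDegree_le 1 (show (P (n + 2)).natDegree ≤ n + 2 by
    rw [h.natDegree])
  rw [h.coeff_self, ← subCoeff_succ P (n + 1)] at c0
  rw [h.apply_mul hd.le, hc, h.apply_mul_succ_succ hd', c0, c1, h.coeff_taylor_self] at key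
  push_cast at key
  linear_combination key

/-- The discrete Painlevé relation: with `βₙ = sₙ - sₙ₊₁` and `γₙ₊₁ = Hₙ₊₁ / Hₙ`, one has
`(η - γₙ) (η - γₙ₊₁) = η (βₙ - n) (βₙ - n + b)`. -/
lemma painleve (h : IsMonicOP L P)
    (hL : ∀ f, L (X * (X + C b) * f) = η * L (taylor 1 f)) {β γ : ℕ → ℝ}
    (hβ : ∀ n, β n = subCoeff P n - subCoeff P (n + 1)) (hγ0 : γ 0 = 0)
    (hγ : ∀ n, γ (n + 1) * L (P n * P n) = L (P (n + 1) * P (n + 1))) (n : ℕ) :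
    (η - γ n) * (η - γ (n + 1)) = η * (β n - n) * (β n - n + b) := by
  have hA : ∀ n : ℕ, γ (n + 1) * (b - n + β (n + 1) + β n) = (n + 1) * η := by
    intro n
    apply mul_right_cancel₀ (h.pos n).ne'
    have := h.sqNorm_succ_mul hL n
    rw [← hγ] at this
    rw [hβ, hβ]
    linear_combination this
  have hB : ∀ n : ℕ, γ (n + 1) * γ n = η * (n * (n + 1) / 2 - subCoeff P n - n * β n) := by
    intro n
    cases n with
    | zero => simp [hγ0]
    | succ n =>
      apply mul_right_cancel₀ (h.pos n).ne'
      have := h.sqNorm_succ_succ hL n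
      rw [← hγ (n + 1), ← hγ] at this
      rw [hβ]
      push_cast
      linear_combination this
  induction n with
  | zero =>
    have h0 : P 0 = 1 := eq_one_of_monic_natDegree_zero (h.monic 0) (h.natDegree 0)
    have h1 : P 1 = X - C (β 0) := by
      have := eq_X_add_C_of_natDegree_le_one (h.natDegree 1).le
      rw [h.coeff_self, ← subCoeff_succ P 0] at this
      rw [this, hβ, subCoeff_zero]
      simp
    -- The base case is the Pearson equation for f = 1, with z(z+b) expanded through P_0 and P_1.
    have e : (X * (X + C b) * 1 : ℝ[X]) = X * P 0 * P 1 + (β 0 + b) • (X * P 0 * P 0) := by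
      rw [h0, h1, smul_eq_C_mul, C_add]
      ring
    have key := hL 1
    rw [e, map_add, map_smul, h.apply_X_mul_succ, h.apply_X_mul_self, ← hβ, ← hγ, taylor_one, C_1,
      show (1 : ℝ[X]) = P 0 * P 0 by rw [h0, one_mul], smul_eq_mul] at key
    apply mul_right_cancel₀ (h.pos 0).ne'
    rw [hγ0]
    push_cast
    linear_combination -η * key
  | succ n ih =>
    have b1 := hB n
    have b2 := hB (n + 1)
    have b3 := hβ n
    push_cast at b2 ⊢
    have hg : γ (n + 1) ≠ 0 := by
      intro h0
      have := hγ n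
      rw [h0, zero_mul] at this
      exact (h.pos (n + 1)).ne this
    apply mul_left_cancel₀ hg
    -- The difference of consecutive `hB` is γ_{n+1}(γ_{n+2} - γ_n) = η(n+1)(1 + β_n - β_{n+1}). The
    -- right side of the goal changes by η(β_{n+1} - β_n - 1)(β_{n+1} + β_n - 2n - 1 + b), and by
    -- `hA` the last factor times γ_{n+1} is (n+1)(η - γ_{n+1}).
    linear_combination γ (n + 1) * ih - (η - γ (n + 1)) * (b2 - b1 - η * b3)
      - η * (β (n + 1) - β n - 1) * hA n

end Pearson
end IsMonicOP

/-! ### The weight: positivity, convergence, Pearson equation -/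

lemma ascPochhammer_eval_pos {b : ℝ} (hb : -1 < b) (k : ℕ) :
    0 < (ascPochhammer ℝ k).eval (b + 1) :=
  ascPochhammer_pos k _ (by linarith)

lemma weight_pos {b η : ℝ} (hb : -1 < b) (hη : 0 < η) (k : ℕ) : 0 < weight b η k := by
  have := ascPochhammer_eval_pos hb k
  unfold weight
  positivity

lemma weight_succ {b η : ℝ} (hb : -1 < b) (k : ℕ) :
    (k + 1) * (k + 1 + b) * weight b η (k + 1) = η * weight b η k := by
  have h1 := (ascPochhammer_eval_pos hb k).ne'
  have h2 : b + 1 + k ≠ 0 := by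
    have : (0 : ℝ) ≤ k := k.cast_nonneg
    linarith
  have h3 : (k.factorial : ℝ) ≠ 0 := by positivity
  have h4 : (k : ℝ) + 1 ≠ 0 := by positivity
  unfold weight
  rw [ascPochhammer_succ_eval, Nat.factorial_succ]
  push_cast
  field_simp
  ring

/-- Only the first factor b+1 can be below 1; all later factors exceed 1. -/
lemma min_le_ascPochhammer_eval {b : ℝ} (hb : -1 < b) (k : ℕ) :
    min 1 (b + 1) ≤ (ascPochhammer ℝ k).eval (b + 1) := by
  cases k with
  | zero => simp
  | succ k =>
    refine (min_le_right _ _).trans ?_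
    induction k with
    | zero => simp
    | succ k ih =>
      rw [ascPochhammer_succ_eval]
      refine ih.trans (le_mul_of_one_le_right (ascPochhammer_eval_pos hb _).le ?_)
      push_cast
      have : (0 : ℝ) ≤ k := k.cast_nonneg
      linarith

/-- Since k^m ≤ m! e^k, the exponential series at eη dominates. -/
lemma summable_pow_mul_weight {b : ℝ} (hb : -1 < b) {η : ℝ} (hη : 0 < η) (m : ℕ) :
    Summable fun k : ℕ => (k : ℝ) ^ m * weight b η k := by
  have hc : 0 < min 1 (b + 1) := lt_min one_pos (by linarith)
  refine Summable.of_nonneg_of_le (fun k => ?_) (fun k => ?_)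
    ((Real.summable_pow_div_factorial (Real.exp 1 * η)).mul_left
      (m.factorial / min 1 (b + 1)))
  · have := weight_pos hb hη k
    positivity
  · have h1 : (k : ℝ) ^ m ≤ m.factorial * Real.exp 1 ^ k := by
      have := Real.pow_div_factorial_le_exp (k : ℝ) k.cast_nonneg m
      rw [div_le_iff₀ (by positivity), ← Real.exp_one_pow] at this
      rwa [mul_comm]
    have h2 : weight b η k ≤ η ^ k / (min 1 (b + 1) * k.factorial) := by
      unfold weight
      gcongr
      exact min_le_ascPochhammer_eval hb k
    calc (k : ℝ) ^ m * weight b η k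
        ≤ (m.factorial * Real.exp 1 ^ k) * (η ^ k / (min 1 (b + 1) * k.factorial)) :=
          mul_le_mul h1 h2 (weight_pos hb hη k).le (by positivity)
      _ = _ := by
          rw [mul_pow]
          field_simp

lemma summable_eval_mul_weight {b : ℝ} (hb : -1 < b) {η : ℝ} (hη : 0 < η) (p : ℝ[X]) :
    Summable fun k : ℕ => p.eval (k : ℝ) * weight b η k := by
  induction p using Polynomial.induction_on' with
  | add p q hp hq => simpa [add_mul] using hp.add hq
  | monomial m a =>
    simpa [mul_assoc] using (summable_pow_mul_weight hb hη m).mul_left a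

/-- The functional `⟨ρ, ·⟩` as a linear map. -/
def functionalLM {b η : ℝ} (hb : -1 < b) (hη : 0 < η) : ℝ[X] →ₗ[ℝ] ℝ where
  toFun := functional b η
  map_add' p q := by
    simp only [functional, eval_add, add_mul]
    exact (summable_eval_mul_weight hb hη p).tsum_add (summable_eval_mul_weight hb hη q)
  map_smul' a p := by
    simp only [functional, eval_smul, smul_eq_mul, mul_assoc, RingHom.id_apply]
    exact tsum_mul_left

@[simp] lemma functionalLM_apply {b η : ℝ} (hb : -1 < b) (hη : 0 < η) (p : ℝ[X]) :
    functionalLM hb hη p = functional b η p := rfl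

lemma functional_mul_self_pos {b η : ℝ} (hb : -1 < b) (hη : 0 < η) {p : ℝ[X]} (hp : p ≠ 0) :
    0 < functional b η (p * p) := by
  obtain ⟨k, hk⟩ : ∃ k : ℕ, p.eval (k : ℝ) ≠ 0 := by
    by_contra! h
    exact hp (eq_zero_of_infinite_isRoot p
      ((Set.infinite_range_of_injective (Nat.cast_injective (R := ℝ))).mono
        (by rintro _ ⟨k, rfl⟩; exact h k)))
  refine (summable_eval_mul_weight hb hη (p * p)).tsum_pos (fun i => ?_) k ?_
  · have := weight_pos hb hη i
    rw [eval_mul]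
    exact mul_nonneg (mul_self_nonneg _) this.le
  · rw [eval_mul]
    exact mul_pos (mul_self_pos.mpr hk) (weight_pos hb hη k)

/-- The discrete Pearson equation in terms of the functional. -/
lemma functional_pearson {b η : ℝ} (hb : -1 < b) (hη : 0 < η) (f : ℝ[X]) :
    functional b η (X * (X + C b) * f) = η * functional b η (taylor 1 f) := by
  unfold functional
  -- The term k = 0 vanishes because of the factor z, so the index can be shifted.
  rw [(summable_eval_mul_weight hb hη _).tsum_eq_zero_add, ← tsum_mul_left]
  simp only [eval_mul, eval_X, Nat.cast_zero, zero_mul, zero_add]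
  refine tsum_congr fun k => ?_
  have := weight_succ (η := η) hb k
  simp only [eval_add, eval_X, eval_C, taylor_eval, Nat.cast_add, Nat.cast_one]
  linear_combination f.eval ((k : ℝ) + 1) * this

/-! ### Differentiation of the functional in η -/

lemma hasDerivAt_weight (b η : ℝ) (hη : 0 < η) (k : ℕ) :
    HasDerivAt (fun t => weight b t k) (k * weight b η k / η) η := by
  unfold weight
  refine ((hasDerivAt_pow k η).div_const
    ((ascPochhammer ℝ k).eval (b + 1) * (k.factorial : ℝ))).congr_deriv ?_
  cases k with
  | zero => simp
  | succ k =>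
    rw [Nat.add_sub_cancel, pow_succ]
    field_simp

lemma weight_le_weight {b : ℝ} (hb : -1 < b) {s t : ℝ} (hs : 0 ≤ s) (hst : s ≤ t) (k : ℕ) :
    weight b s k ≤ weight b t k := by
  have := ascPochhammer_eval_pos hb k
  unfold weight
  gcongr

lemma hasDerivAt_functional {b : ℝ} (hb : -1 < b) {η : ℝ} (hη : 0 < η) (p : ℝ[X]) :
    HasDerivAt (fun t => functional b t p) (functional b η (X * p) / η) η := by
  have hmem : η ∈ Set.Ioo (η / 2) (2 * η) := ⟨by linarith, by linarith⟩
  -- Uniform bound on (η/2, 2η): the weight increases with its parameter, and the denominator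
  -- exceeds η/2.
  have hu : Summable fun k : ℕ => ‖(X * p).eval (k : ℝ) * weight b (2 * η) k‖ / (η / 2) :=
    (summable_eval_mul_weight hb (by linarith) (X * p)).norm.div_const _
  have key := hasDerivAt_tsum_of_isPreconnected (g := fun (k : ℕ) t => p.eval (k : ℝ) * weight b t k)
    (g' := fun (k : ℕ) t => p.eval (k : ℝ) * (k * weight b t k / t)) hu isOpen_Ioo
    isPreconnected_Ioo
    (fun k t ht => (hasDerivAt_weight b t (by linarith [ht.1]) k).const_mul _)
    (fun k t ht => ?_) hmem (summable_eval_mul_weight hb hη p) hmem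
  · refine key.congr_deriv ?_
    rw [functional, ← tsum_div_const]
    refine tsum_congr fun k => ?_
    rw [eval_mul, eval_X]
    ring
  · have ht0 : 0 < t := by linarith [ht.1]
    have hw := weight_pos hb ht0 k
    have hw' := weight_le_weight hb ht0.le ht.2.le k
    rw [eval_mul, eval_X, mul_div_assoc', norm_div, Real.norm_of_nonneg ht0.le, ← mul_assoc,
      mul_comm (p.eval _), norm_mul _ (weight b t k), norm_mul _ (weight b (2 * η) k),
      Real.norm_of_nonneg hw.le, Real.norm_of_nonneg (hw.le.trans hw')]
    have := norm_nonneg ((k : ℝ) * p.eval (k : ℝ))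
    have := hw.trans_le hw'
    gcongr
    exact ht.1.le

/-- The derivative is again a functional of this type, for zp, divided by η; hence the induction
over all p. -/
lemma contDiffOn_functional {b : ℝ} (hb : -1 < b) (p : ℝ[X]) (m : ℕ) :
    ContDiffOn ℝ m (fun t => functional b t p) (Set.Ioi 0) := by
  induction m generalizing p with
  | zero =>
    rw [Nat.cast_zero, contDiffOn_zero]
    exact fun t ht => (hasDerivAt_functional hb ht p).continuousAt.continuousWithinAt
  | succ m ih =>
    rw [Nat.cast_succ, contDiffOn_succ_iff_deriv_of_isOpen isOpen_Ioi]
    refine ⟨fun t ht => (hasDerivAt_functional hb ht p).differentiableAt.differentiableWithinAt,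
      by simp, ?_⟩
    refine ((ih (X * p)).div contDiffOn_id fun t ht => (ne_of_gt ht)).congr fun t ht => ?_
    exact (hasDerivAt_functional hb ht p).deriv

lemma functional_eq_sum {b η : ℝ} (hb : -1 < b) (hη : 0 < η) {q : ℝ[X]} {N : ℕ}
    (hq : q.natDegree < N) (r : ℝ[X]) :
    functional b η (q * r)
      = ∑ i ∈ Finset.range N, q.coeff i * functional b η (X ^ i * r) := by
  simp only [← functionalLM_apply hb hη]
  conv_lhs => rw [q.as_sum_range_C_mul_X_pow' hq, Finset.sum_mul, map_sum]
  refine Finset.sum_congr rfl fun i _ => ?_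
  rw [mul_assoc, ← smul_eq_C_mul, map_smul, smul_eq_mul]

/-! ### Gram–Schmidt yields the monic orthogonal polynomials -/

lemma monicOP_eq (b η : ℝ) (n : ℕ) :
    monicOP b η n = X ^ n - ∑ m ∈ Finset.range n,
      C (functional b η (X ^ n * monicOP b η m) / sqNorm b η m) * monicOP b η m := by
  rw [monicOP, Finset.sum_range]
  rfl

lemma monicOP_degree_sub_lt {b η : ℝ} (n : ℕ) (ih : ∀ m < n, (monicOP b η m).degree = m) :
    (X ^ n - monicOP b η n).degree < (n : WithBot ℕ) := by
  rw [monicOP_eq, sub_sub_cancel]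
  rw [← mem_degreeLT]
  refine Submodule.sum_mem _ fun m hm => ?_
  have hm := Finset.mem_range.mp hm
  rw [← smul_eq_C_mul]
  refine Submodule.smul_mem _ _ ?_
  rw [mem_degreeLT, ih m hm]
  exact_mod_cast hm

lemma monicOP_degree (b η : ℝ) (n : ℕ) : (monicOP b η n).degree = n := by
  induction n using Nat.strong_induction_on with
  | _ n ih =>
    have h := monicOP_degree_sub_lt n ih
    have := degree_sub_eq_left_of_degree_lt (p := X ^ n) (q := X ^ n - monicOP b η n)
      (by rwa [degree_X_pow])
    rwa [sub_sub_cancel, degree_X_pow] at this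

lemma monicOP_monic (b η : ℝ) (n : ℕ) : (monicOP b η n).Monic := by
  have h := monicOP_degree_sub_lt (b := b) (η := η) n fun m _ => monicOP_degree b η m
  have := (monic_X_pow (R := ℝ) n).sub_of_left (q := X ^ n - monicOP b η n)
    (by rwa [degree_X_pow])
  rwa [sub_sub_cancel] at this

lemma sqNorm_pos {b η : ℝ} (hb : -1 < b) (hη : 0 < η) (n : ℕ) : 0 < sqNorm b η n :=
  functional_mul_self_pos hb hη (monicOP_monic b η n).ne_zero

lemma monicOP_orth_monicOP {b η : ℝ} (hb : -1 < b) (hη : 0 < η) {n m : ℕ} (hm : m < n) :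
    functional b η (monicOP b η m * monicOP b η n) = 0 := by
  induction n using Nat.strong_induction_on generalizing m with
  | _ n ih =>
    rw [monicOP_eq b η n, mul_sub, Finset.mul_sum, ← functionalLM_apply hb hη, map_sub, map_sum,
      Finset.sum_eq_single m]
    · rw [mul_left_comm, ← smul_eq_C_mul, map_smul, functionalLM_apply, functionalLM_apply,
        ← sqNorm, smul_eq_mul, div_mul_cancel₀ _ (sqNorm_pos hb hη m).ne', mul_comm, sub_self]
    · intro k hk hkm
      rw [mul_left_comm, ← smul_eq_C_mul, map_smul, functionalLM_apply]
      rcases hkm.lt_or_gt with h | h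
      · rw [mul_comm (monicOP b η m), ih m hm h, smul_zero]
      · rw [ih k (Finset.mem_range.mp hk) h, smul_zero]
    · exact fun h => absurd (Finset.mem_range.mpr hm) h

/-- Induction on the degree of q, stripping its leading term with a multiple of the P of that
degree. -/
lemma monicOP_orth {b η : ℝ} (hb : -1 < b) (hη : 0 < η) (n : ℕ) (q : ℝ[X])
    (hq : q.degree < (n : WithBot ℕ)) : functional b η (q * monicOP b η n) = 0 := by
  generalize hd : q.natDegree = d
  induction d using Nat.strong_induction_on generalizing q with
  | _ d ih =>
    subst hd
    by_cases h0 : q = 0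
    · simp [h0, functional]
    set r := q - C q.leadingCoeff * monicOP b η q.natDegree with hr
    have hlt : q.natDegree < n := by
      rw [degree_eq_natDegree h0] at hq
      exact_mod_cast hq
    have hrd : r.degree < q.degree := by
      refine degree_sub_lt_left ?_ h0 ?_
      · rw [degree_C_mul (leadingCoeff_ne_zero.mpr h0), monicOP_degree, degree_eq_natDegree h0]
      · rw [leadingCoeff_mul, leadingCoeff_C, (monicOP_monic b η _), mul_one]
    have hq' : q = r + C q.leadingCoeff * monicOP b η q.natDegree := by rw [hr]; ring
    have h1 : functional b η (r * monicOP b η n) = 0 := by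
      by_cases hr0 : r = 0
      · simp [hr0, functional]
      · exact ih _ (natDegree_lt_natDegree hr0 hrd) r (hrd.trans hq) rfl
    rw [hq', add_mul, ← functionalLM_apply hb hη, map_add, functionalLM_apply, h1, mul_assoc,
      ← smul_eq_C_mul, map_smul, functionalLM_apply, monicOP_orth_monicOP hb hη hlt, smul_zero,
      add_zero]

lemma isMonicOP {b η : ℝ} (hb : -1 < b) (hη : 0 < η) :
    IsMonicOP (functionalLM hb hη) (monicOP b η) where
  monic := monicOP_monic b η
  natDegree n := natDegree_eq_of_degree_eq_some (monicOP_degree b η n)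
  orth := monicOP_orth hb hη
  pos := sqNorm_pos hb hη

/-! ### Smooth dependence on η -/

lemma contDiffOn_functional_of_coeff {b : ℝ} (hb : -1 < b) {m N : ℕ} {q : ℝ → ℝ[X]}
    (hN : ∀ t, (q t).natDegree < N)
    (hq : ∀ i, ContDiffOn ℝ m (fun t => (q t).coeff i) (Set.Ioi 0)) :
    ContDiffOn ℝ m (fun t => functional b t (q t)) (Set.Ioi 0) := by
  have h : ContDiffOn ℝ m (fun t => ∑ i ∈ Finset.range N,
      (q t).coeff i * functional b t (X ^ i * 1)) (Set.Ioi 0) :=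
    ContDiffOn.sum fun i _ => (hq i).mul (contDiffOn_functional hb _ m)
  refine h.congr fun t ht => ?_
  have := functional_eq_sum hb ht (hN t) 1
  rwa [mul_one] at this

lemma natDegree_monicOP (b η : ℝ) (n : ℕ) : (monicOP b η n).natDegree = n :=
  natDegree_eq_of_degree_eq_some (monicOP_degree b η n)

lemma contDiffOn_functional_mul {b : ℝ} (hb : -1 < b) {m M N : ℕ} {p q : ℝ → ℝ[X]}
    (hM : ∀ t, (p t).natDegree ≤ M) (hN : ∀ t, (q t).natDegree ≤ N)
    (hp : ∀ i, ContDiffOn ℝ m (fun t => (p t).coeff i) (Set.Ioi 0))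
    (hq : ∀ i, ContDiffOn ℝ m (fun t => (q t).coeff i) (Set.Ioi 0)) :
    ContDiffOn ℝ m (fun t => functional b t (p t * q t)) (Set.Ioi 0) := by
  refine contDiffOn_functional_of_coeff hb (N := M + N + 1)
    (fun t => Nat.lt_succ_of_le (natDegree_mul_le_of_le (hM t) (hN t))) fun i => ?_
  simp only [coeff_mul]
  exact ContDiffOn.sum fun x _ => (hp x.1).mul (hq x.2)

lemma contDiffOn_monicOP_coeff {b : ℝ} (hb : -1 < b) (m n i : ℕ) :
    ContDiffOn ℝ m (fun t => (monicOP b t n).coeff i) (Set.Ioi 0) := by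
  induction n using Nat.strong_induction_on generalizing i with
  | _ n ih =>
    simp only [monicOP_eq b _ n, coeff_sub, finsetSum_coeff, coeff_C_mul]
    refine contDiffOn_const.sub (ContDiffOn.sum fun k hk => ?_)
    have hk := Finset.mem_range.mp hk
    have hd : ∀ t, (monicOP b t k).natDegree ≤ k := fun t => (natDegree_monicOP b t k).le
    refine ContDiffOn.mul (ContDiffOn.div ?_ ?_ ?_) (ih k hk i)
    · exact contDiffOn_functional_mul hb (p := fun _ => X ^ n) (fun _ => natDegree_X_pow_le n) hd
        (fun _ => contDiffOn_const) (ih k hk)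
    · exact contDiffOn_functional_mul hb hd hd (ih k hk) (ih k hk)
    · exact fun t ht => (sqNorm_pos hb ht k).ne'

lemma contDiffOn_sqNorm {b : ℝ} (hb : -1 < b) (m n : ℕ) :
    ContDiffOn ℝ m (fun t => sqNorm b t n) (Set.Ioi 0) :=
  contDiffOn_functional_mul hb (fun t => (natDegree_monicOP b t n).le)
    (fun t => (natDegree_monicOP b t n).le) (contDiffOn_monicOP_coeff hb m n)
    (contDiffOn_monicOP_coeff hb m n)

lemma differentiableAt_monicOP_coeff {b : ℝ} (hb : -1 < b) {η : ℝ} (hη : 0 < η) (n i : ℕ) :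
    DifferentiableAt ℝ (fun t => (monicOP b t n).coeff i) η :=
  ((contDiffOn_monicOP_coeff hb 1 n i).differentiableOn (by simp)).differentiableAt
    (Ioi_mem_nhds hη)

/-! ### Toda equations -/

/-- Derivative in `η` of the pairing of `Pₙ` with a fixed polynomial. -/
lemma hasDerivAt_functional_monicOP_mul {b : ℝ} (hb : -1 < b) {η : ℝ} (hη : 0 < η) (n : ℕ)
    (Q : ℝ[X]) :
    HasDerivAt (fun t => functional b t (monicOP b t n * Q))
      (∑ i ∈ Finset.range n, deriv (fun t => (monicOP b t n).coeff i) η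
          * functional b η (X ^ i * Q)
        + functional b η (X * monicOP b η n * Q) / η) η := by
  have hd : ∀ t, (monicOP b t n).natDegree < n + 1 := fun t => by
    rw [natDegree_monicOP]; exact n.lt_succ_self
  have h := HasDerivAt.fun_sum (u := Finset.range (n + 1)) fun i _ =>
    (differentiableAt_monicOP_coeff hb hη n i).hasDerivAt.mul
      (hasDerivAt_functional hb hη (X ^ i * Q))
  refine (h.congr_of_eventuallyEq ?_).congr_deriv ?_
  · filter_upwards [Ioi_mem_nhds hη] with t ht
    exact functional_eq_sum hb ht (hd t) Q
  -- The leading coefficient is constantly 1, so only the lower coefficients contribute derivatives.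
  · have hn : deriv (fun t => (monicOP b t n).coeff n) η = 0 := by
      have : (fun t => (monicOP b t n).coeff n) = fun _ => 1 := by
        funext t
        have := monicOP_monic b t n
        rwa [Monic, leadingCoeff, natDegree_monicOP] at this
      rw [this, deriv_const]
    rw [Finset.sum_add_distrib, Finset.sum_range_succ, hn, zero_mul, add_zero]
    congr 1
    rw [mul_comm X, mul_assoc, functional_eq_sum hb hη (hd η), Finset.sum_div]
    refine Finset.sum_congr rfl fun i _ => ?_
    rw [mul_left_comm, mul_div_assoc]

/-- `ϑ Hₙ = βₙ Hₙ`. -/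
lemma hasDerivAt_sqNorm {b : ℝ} (hb : -1 < b) {η : ℝ} (hη : 0 < η) (n : ℕ) :
    HasDerivAt (fun t => sqNorm b t n)
      (functional b η (X * monicOP b η n * monicOP b η n) / η) η := by
  refine ((hasDerivAt_functional_monicOP_mul hb hη n (monicOP b η n)).congr_of_eventuallyEq
    ?_).congr_deriv ?_
  · filter_upwards [Ioi_mem_nhds hη] with t ht
    -- One factor may be frozen: pairing P_n at t with any monic polynomial of degree n, such as P_n
    -- at η, still gives H_n at t.
    have h := (isMonicOP hb ht).apply_mul (natDegree_monicOP b η n).le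
    have hc := (isMonicOP hb hη).coeff_self n
    rw [hc, one_mul] at h
    rw [mul_comm]
    exact h.symm
  · rw [Finset.sum_eq_zero, zero_add]
    intro i hi
    rw [monicOP_orth hb hη, mul_zero]
    rw [degree_X_pow]
    exact_mod_cast Finset.mem_range.mp hi

/-- `ϑ sₙ = -γₙ` for the coefficient `sₙ` of `z ^ (n - 1)` in `Pₙ`. -/
lemma hasDerivAt_subCoeff {b : ℝ} (hb : -1 < b) {η : ℝ} (hη : 0 < η) (n : ℕ) :
    HasDerivAt (fun t => subCoeff (monicOP b t) n) (-gamma b n η / η) η := by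
  cases n with
  | zero => simpa [gamma] using hasDerivAt_const η (0 : ℝ)
  | succ n =>
    simp only [subCoeff_succ]
    refine (differentiableAt_monicOP_coeff hb hη (n + 1) n).hasDerivAt.congr_deriv ?_
    -- Differentiate ⟨P_{n+1}, Q⟩ = 0 with Q frozen as P_n at η; of the coefficient derivatives only
    -- that of z^n survives.
    have h1 := hasDerivAt_functional_monicOP_mul hb hη (n + 1) (monicOP b η n)
    have h2 : HasDerivAt (fun t => functional b t (monicOP b t (n + 1) * monicOP b η n)) 0 η := by
      refine (hasDerivAt_const η (0 : ℝ)).congr_of_eventuallyEq ?_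
      filter_upwards [Ioi_mem_nhds hη] with t ht
      rw [mul_comm, monicOP_orth hb ht]
      rw [monicOP_degree]
      exact_mod_cast n.lt_succ_self
    have h3 := h1.unique h2
    have h4 : functional b η (X ^ n * monicOP b η n) = sqNorm b η n := by
      have := (isMonicOP hb hη).apply_mul (natDegree_X_pow_le (R := ℝ) n)
      rwa [coeff_X_pow_self, one_mul] at this
    rw [Finset.sum_range_succ, Finset.sum_eq_zero, zero_add, h4] at h3
    · have hH := (sqNorm_pos hb hη n).ne'
      rw [gamma, jacobi]
      field_simp
      field_simp at h3
      linarith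
    · intro i hi
      rw [monicOP_orth hb hη, mul_zero]
      rw [degree_X_pow]
      exact_mod_cast Finset.mem_range.mp hi

lemma beta_eq {b : ℝ} (hb : -1 < b) {η : ℝ} (hη : 0 < η) (n : ℕ) :
    beta b n η = subCoeff (monicOP b η) n - subCoeff (monicOP b η) (n + 1) := by
  rw [beta, jacobi, div_eq_iff (sqNorm_pos hb hη n).ne']
  exact (isMonicOP hb hη).apply_X_mul_self n

lemma gamma_succ_eq {b : ℝ} (hb : -1 < b) {η : ℝ} (hη : 0 < η) (n : ℕ) :
    gamma b (n + 1) η = sqNorm b η (n + 1) / sqNorm b η n := by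
  rw [gamma, jacobi]
  congr 1
  rw [mul_right_comm]
  exact (isMonicOP hb hη).apply_X_mul_succ n

lemma gamma_pos {b : ℝ} (hb : -1 < b) {η : ℝ} (hη : 0 < η) {n : ℕ} (hn : 1 ≤ n) :
    0 < gamma b n η := by
  obtain ⟨n, rfl⟩ := Nat.exists_eq_add_of_le' hn
  rw [gamma_succ_eq hb hη]
  exact div_pos (sqNorm_pos hb hη _) (sqNorm_pos hb hη _)

lemma contDiffOn_gamma {b : ℝ} (hb : -1 < b) (m n : ℕ) :
    ContDiffOn ℝ m (gamma b n) (Set.Ioi 0) := by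
  cases n with
  | zero => exact contDiffOn_const
  | succ n =>
    exact ((contDiffOn_sqNorm hb m (n + 1)).div (contDiffOn_sqNorm hb m n)
      fun t ht => (sqNorm_pos hb ht n).ne').congr fun t ht => gamma_succ_eq hb ht n

/-- The Toda equation for `βₙ`. -/
lemma hasDerivAt_beta {b : ℝ} (hb : -1 < b) {η : ℝ} (hη : 0 < η) (n : ℕ) :
    HasDerivAt (beta b n) ((gamma b (n + 1) η - gamma b n η) / η) η := by
  refine (((hasDerivAt_subCoeff hb hη n).sub
    (hasDerivAt_subCoeff hb hη (n + 1))).congr_of_eventuallyEq ?_).congr_deriv (by ring)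
  filter_upwards [Ioi_mem_nhds hη] with t ht
  exact beta_eq hb ht n

/-- The Toda equation for `γₙ₊₁`. -/
lemma hasDerivAt_gamma_succ {b : ℝ} (hb : -1 < b) {η : ℝ} (hη : 0 < η) (n : ℕ) :
    HasDerivAt (gamma b (n + 1))
      (gamma b (n + 1) η * (beta b (n + 1) η - beta b n η) / η) η := by
  have hH := (sqNorm_pos hb hη n).ne'
  have hH' := (sqNorm_pos hb hη (n + 1)).ne'
  refine (((hasDerivAt_sqNorm hb hη (n + 1)).div (hasDerivAt_sqNorm hb hη n)
    hH).congr_of_eventuallyEq ?_).congr_deriv ?_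
  · filter_upwards [Ioi_mem_nhds hη] with t ht
    exact gamma_succ_eq hb ht n
  · rw [gamma_succ_eq hb hη, beta, beta, jacobi, jacobi]
    field_simp

/-! ### The first-order system -/

lemma euler_beta {b : ℝ} (hb : -1 < b) {η : ℝ} (hη : 0 < η) (n : ℕ) :
    euler (beta b n) η = gamma b (n + 1) η - gamma b n η := by
  rw [euler, (hasDerivAt_beta hb hη n).deriv, mul_div_cancel₀ _ hη.ne']

lemma gamma_succ_mul_sqNorm {b : ℝ} (hb : -1 < b) {η : ℝ} (hη : 0 < η) (n : ℕ) :
    gamma b (n + 1) η * sqNorm b η n = sqNorm b η (n + 1) := by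
  rw [gamma_succ_eq hb hη, div_mul_cancel₀ _ (sqNorm_pos hb hη n).ne']

/-- The Toda equation, with β_{n-1} eliminated by `sqNorm_succ_mul`. -/
lemma euler_gamma {b : ℝ} (hb : -1 < b) {η : ℝ} (hη : 0 < η) {n : ℕ} (hn : 1 ≤ n) :
    euler (gamma b n) η = (b - n + 1 + 2 * beta b n η) * gamma b n η - n * η := by
  obtain ⟨n, rfl⟩ := Nat.exists_eq_add_of_le' hn
  have h := (isMonicOP hb hη).sqNorm_succ_mul (functional_pearson hb hη) n
  rw [functionalLM_apply, functionalLM_apply, ← sqNorm, ← sqNorm,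
    ← gamma_succ_mul_sqNorm hb hη] at h
  have h' : (b - n + subCoeff (monicOP b η) n - subCoeff (monicOP b η) (n + 2))
      * gamma b (n + 1) η = (n + 1) * η :=
    mul_right_cancel₀ (sqNorm_pos hb hη n).ne' (by linear_combination h)
  rw [euler, (hasDerivAt_gamma_succ hb hη n).deriv, mul_div_cancel₀ _ hη.ne']
  have h1 := beta_eq hb hη n
  have h2 := beta_eq hb hη (n + 1)
  push_cast
  linear_combination -h' - gamma b (n + 1) η * (h1 + h2)

/-- By the Toda equation ϑβ_n + γ_n is γ_{n+1}, so this is `painleve` rearranged. -/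
lemma beta_gamma_system {b : ℝ} (hb : -1 < b) {η : ℝ} (hη : 0 < η) (n : ℕ) :
    (η - gamma b n η) * (euler (beta b n) η + gamma b n η) =
      η * (η + (b - n) * n + (2 * n - b - beta b n η) * beta b n η - gamma b n η) := by
  have h := (isMonicOP hb hη).painleve (functional_pearson hb hη) (β := fun n => beta b n η)
    (γ := fun n => gamma b n η) (beta_eq hb hη) rfl (gamma_succ_mul_sqNorm hb hη) n
  rw [euler_beta hb hη]
  linear_combination -h

end GenCharlier

end

open GenCharlier in
theorem mainTheorem4 (b : ℝ) (hb : -1 < b) (n : ℕ) (hn : 1 ≤ n) :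
    -- the orthogonal polynomials are well defined and `β`, `γ` are their recursion coefficients
    (∀ η : ℝ, 0 < η →
      (∀ p : ℝ[X], Summable fun k : ℕ => p.eval (k : ℝ) * GenCharlier.weight b η k) ∧
      (GenCharlier.monicOP b η n).Monic ∧
      (GenCharlier.monicOP b η n).natDegree = n ∧
      (∀ m : ℕ, m < n →
        GenCharlier.functional b η (GenCharlier.monicOP b η n * X ^ m) = 0) ∧
      0 < GenCharlier.sqNorm b η n ∧
      X * GenCharlier.monicOP b η n =
        GenCharlier.monicOP b η (n + 1)
          + C (GenCharlier.beta b n η) * GenCharlier.monicOP b η n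
          + C (GenCharlier.gamma b n η) * GenCharlier.monicOP b η (n - 1) ∧
      0 < GenCharlier.gamma b n η) ∧
    -- regularity in `η`
    ContDiffOn ℝ 2 (GenCharlier.gamma b n) (Set.Ioi 0) ∧
    DifferentiableOn ℝ (GenCharlier.beta b n) (Set.Ioi 0) ∧
    ∀ η : ℝ, 0 < η →
      -- the first order system for `(β, γ)`
      ((η - GenCharlier.gamma b n η) *
          (GenCharlier.euler (GenCharlier.beta b n) η + GenCharlier.gamma b n η) =
        η * (η + (b - n) * n
          + (2 * n - b - GenCharlier.beta b n η) * GenCharlier.beta b n η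
          - GenCharlier.gamma b n η)) ∧
      (GenCharlier.euler (GenCharlier.gamma b n) η =
        (b - n + 1 + 2 * GenCharlier.beta b n η) * GenCharlier.gamma b n η - n * η) ∧
      -- `β` in terms of `γ`
      (GenCharlier.beta b n η =
        1 / 2 * (GenCharlier.euler (fun t => Real.log (GenCharlier.gamma b n t)) η
          + n * η / GenCharlier.gamma b n η - b + n - 1)) ∧
      -- the second order equation for `γ`
      ((1 - GenCharlier.gamma b n η / η) *
          (GenCharlier.euler (fun t =>
              GenCharlier.euler (GenCharlier.gamma b n) t / GenCharlier.gamma b n t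
                + n * t / GenCharlier.gamma b n t) η
            + 2 * GenCharlier.gamma b n η)
          + 2 * (GenCharlier.gamma b n η - η + (n - b) * n) =
        -(1 / 2) * (GenCharlier.euler (GenCharlier.gamma b n) η / GenCharlier.gamma b n η
              + n * η / GenCharlier.gamma b n η) ^ 2
          + (n + 1) * (GenCharlier.euler (GenCharlier.gamma b n) η / GenCharlier.gamma b n η
              + n * η / GenCharlier.gamma b n η)
          + 1 / 2 * (-b + n - 1) * (-b + 3 * n + 1)) := by
  refine ⟨fun η hη => ⟨summable_eval_mul_weight hb hη, monicOP_monic b η n,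
    natDegree_monicOP b η n, fun m hm => ?_, sqNorm_pos hb hη n, ?_, gamma_pos hb hη hn⟩,
    contDiffOn_gamma hb 2 n,
    fun η hη => (hasDerivAt_beta hb hη n).differentiableAt.differentiableWithinAt,
    fun η hη => ⟨beta_gamma_system hb hη n, euler_gamma hb hη hn, ?_, ?_⟩⟩
  · rw [mul_comm]
    refine monicOP_orth hb hη n _ ?_
    rw [degree_X_pow]
    exact_mod_cast hm
  · obtain ⟨n, rfl⟩ := Nat.exists_eq_add_of_le' hn
    exact (isMonicOP hb hη).X_mul_eq n
      (div_mul_cancel₀ _ (sqNorm_pos hb hη (n + 1)).ne').symm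
      (div_mul_cancel₀ _ (sqNorm_pos hb hη n).ne').symm
  · have hγ := (gamma_pos hb hη hn).ne'
    have hd : DifferentiableAt ℝ (GenCharlier.gamma b n) η :=
      ((contDiffOn_gamma hb 1 n).differentiableOn (by simp)).differentiableAt (Ioi_mem_nhds hη)
    have h := euler_gamma hb hη hn
    rw [euler] at h ⊢
    rw [deriv.log hd hγ]
    field_simp
    linear_combination -h
  -- The combination in the ODE is affine in β_n, so the ODE is twice the first equation of the
  -- system divided by η.
  · have hF : ∀ t : ℝ, 0 < t →
        euler (GenCharlier.gamma b n) t / GenCharlier.gamma b n t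
          + n * t / GenCharlier.gamma b n t = b - n + 1 + 2 * GenCharlier.beta b n t := by
      intro t ht
      have hγ := (gamma_pos hb ht hn).ne'
      rw [euler_gamma hb ht hn]
      field_simp
      ring
    have hE : euler (fun t => euler (GenCharlier.gamma b n) t / GenCharlier.gamma b n t
        + n * t / GenCharlier.gamma b n t) η = 2 * euler (GenCharlier.beta b n) η := by
      have h : HasDerivAt (fun t => euler (GenCharlier.gamma b n) t / GenCharlier.gamma b n t
          + n * t / GenCharlier.gamma b n t) (2 * deriv (GenCharlier.beta b n) η) η := by
        refine (((hasDerivAt_beta hb hη n).differentiableAt.hasDerivAt.const_mul 2).const_add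
          (b - n + 1)).congr_of_eventuallyEq ?_
        filter_upwards [Ioi_mem_nhds hη] with t ht
        exact hF t ht
      rw [euler, h.deriv, euler]
      ring
    have hs := beta_gamma_system hb hη n
    have hs' : (1 - GenCharlier.gamma b n η / η)
        * (euler (GenCharlier.beta b n) η + GenCharlier.gamma b n η)
        = η + (b - n) * n + (2 * n - b - GenCharlier.beta b n η) * GenCharlier.beta b n η
          - GenCharlier.gamma b n η := by
      apply mul_left_cancel₀ hη.ne'
      rw [← hs]
      field_simp
    rw [hE, hF η hη]
    linear_combination 2 * hs'
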